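/- Let $N\ge 1$, let $Q=(0,1)^N$ and let $T^N=\mathbb R^N/\mathbb Z^N$; all spaces are complex. Let $H^1(Q)$ be the usual Sobolev space, $H^1_0(Q)$ the closure of $C_c^\infty(Q)$ in it, and let $H^1(T^N)$ be the Sobolev space of the torus, i.e. of all $u\in L^2(Q)$ having a weak gradient $\nabla u\in L^2(Q)^N$ with respect to smooth $\mathbb Z^N$-periodic test functions. Let $H^{-1}(T^N)$ be the space of bounded antilinear functionals on $H^1(T^N)$. Put $$\mathrm{Har}(Q)=\Big\{u\in H^1(Q):\int_Q\nabla u\cdot\overline{\nabla v}\,dx=0\ \ \forall v\in H^1_0(Q)\Big\},\qquad \mathrm{Har}(T^N)=\Big\{u\in H^1(T^N):\int_Q\nabla u\cdot\overline{\nabla v}\,dx=0\ \ \forall v\in H^1_0(Q)\Big\},$$ and let $V$ and $\tilde V$ be the orthogonal complements in $L^2(Q)$ of $\mathrm{Har}(Q)$ and of $\mathrm{Har}(T^N)$, respectively. For $f\in H^{-1}(T^N)$ put $\mu_0(f)=\langle f,1\rangle$ and let $u_f\in H^1(T^N)$ be the unique function with $\int_Q u_f\,dx=0$ and $$\int_Q\nabla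 u_f\cdot\overline{\nabla v}\,dx=-\Big(\langle f,v\rangle-\mu_0(f)\int_Q\overline v\,dx\Big)\qquad\forall v\in H^1(T^N).$$ Equip $H^{-1}(T^N)$ with the inner product $(\nabla u_f|\nabla u_g)_{L^2(Q)^N}+\mu_0(f)\overline{\mu_0(g)}$, and let $$H=\{w\in H^{-1}(T^N):\langle w,v\rangle=0\ \ \forall v\in\mathrm{Har}(T^N)\}$$ with this inner product. Then the norm induced by this inner product on $H^{-1}(T^N)$ is equivalent to the dual norm, $V$ and $\tilde V$ are closed subspaces of $L^2(Q)$, and both $V$ and $\tilde V$ (with the $L^2$ norm) are densely and compactly embedded in $H$: identifying $f$ with the functional $v\mapsto\int_Q f\,\overline v\,dx$ defines an injective, compact linear map with dense range from $V$ into $H$, and likewise from $\tilde V$ into $H$. -/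

import Mathlib

open MeasureTheory
open scoped ContDiff ComplexConjugate InnerProductSpace

namespace MomentHeat

noncomputable section

/-- The open unit cube `(0,1)^N`. -/
def cube (N : ℕ) : Set (Fin N → ℝ) := Set.univ.pi fun _ => Set.Ioo (0 : ℝ) 1

/-- The complex Hilbert space `L²((0,1)^N)`, which is also `L²(T^N)`. -/
abbrev L2 (N : ℕ) : Type := Lp ℂ 2 (volume.restrict (cube N))

/-- Pairs `(u, g)` of a function `u` and a vector field `g`, all components in `L²((0,1)^N)`, with
the Hilbert norm `(‖u‖² + ∑ᵢ ‖gᵢ‖²)^(1/2)`. A Sobolev function `u` is represented by the pair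
`(u, ∇u)`, so that this norm is the `H¹` norm. -/
abbrev GradPair (N : ℕ) : Type := WithLp 2 (L2 N × PiLp 2 fun _ : Fin N => L2 N)

/-- The classical partial derivative in the `i`-th coordinate direction. -/
def partialD {N : ℕ} (i : Fin N) (φ : (Fin N → ℝ) → ℂ) (x : Fin N → ℝ) : ℂ :=
  fderiv ℝ φ x (Pi.single i 1)

/-- Test functions on the torus: smooth `ℤ^N`-periodic functions on `ℝ^N`. -/
structure IsTorusTest {N : ℕ} (φ : (Fin N → ℝ) → ℂ) : Prop where
  smooth : ContDiff ℝ ∞ φ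
  periodic : ∀ (i : Fin N) (x : Fin N → ℝ), φ (x + Pi.single i 1) = φ x

/-- Test functions on the open cube: smooth functions with compact support in `(0,1)^N`. -/
structure IsCubeTest {N : ℕ} (φ : (Fin N → ℝ) → ℂ) : Prop where
  smooth : ContDiff ℝ ∞ φ
  compact : HasCompactSupport φ
  support : tsupport φ ⊆ cube N

/-- `p = (u, g)` satisfies `∫ u ∂ᵢφ = - ∫ gᵢ φ` for all `i`. -/
def IsWeakGradAgainst {N : ℕ} (p : GradPair N) (φ : (Fin N → ℝ) → ℂ) : Prop :=
  ∀ i : Fin N, ∫ x in cube N, p.fst x * partialD i φ x = -∫ x in cube N, p.snd i x * φ x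

lemma memLp_of_continuous {N : ℕ} {φ : (Fin N → ℝ) → ℂ} (hφ : Continuous φ) :
    MemLp φ 2 (volume.restrict (cube N)) := by
  have hsub : cube N ⊆ Set.Icc (0 : Fin N → ℝ) 1 := by
    intro x hx
    have hx' : ∀ i, x i ∈ Set.Ioo (0 : ℝ) 1 := by simpa [cube] using hx
    exact ⟨fun i => (hx' i).1.le, fun i => (hx' i).2.le⟩
  obtain ⟨C, hC⟩ := (isCompact_Icc (a := (0 : Fin N → ℝ)) (b := 1)).exists_bound_of_continuousOn
    hφ.continuousOn
  have : IsFiniteMeasure (volume.restrict (cube N)) :=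
    ⟨by
      rw [Measure.restrict_apply_univ]
      exact lt_of_le_of_lt (measure_mono hsub) isCompact_Icc.measure_lt_top⟩
  refine MemLp.of_bound hφ.aestronglyMeasurable C ?_
  refine (ae_restrict_mem (MeasurableSet.univ_pi fun _ => measurableSet_Ioo)).mono ?_
  intro x hx
  exact hC x (hsub hx)

/-- Integration against a continuous function is a bounded linear functional on `L²`. -/
lemma exists_integral_clm {N : ℕ} {φ : (Fin N → ℝ) → ℂ} (hφ : Continuous φ) :
    ∃ ℓ : L2 N →L[ℂ] ℂ, ∀ u : L2 N, ℓ u = ∫ x in cube N, u x * φ x := by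
  have h := memLp_of_continuous (N := N) (Complex.continuous_conj.comp hφ)
  refine ⟨innerSL ℂ (h.toLp _), fun u => ?_⟩
  rw [innerSL_apply_apply, MeasureTheory.L2.inner_def]
  refine integral_congr_ae ?_
  filter_upwards [h.coeFn_toLp] with x hx
  rw [hx]
  simp [RCLike.inner_apply]

lemma continuous_partialD {N : ℕ} {φ : (Fin N → ℝ) → ℂ} (hφ : ContDiff ℝ ∞ φ) (i : Fin N) :
    Continuous (partialD i φ) :=
  (hφ.continuous_fderiv (by simp)).clm_apply continuous_const

lemma exists_weakGrad_clm {N : ℕ} {φ : (Fin N → ℝ) → ℂ} (hφ : ContDiff ℝ ∞ φ) (i : Fin N) :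
    ∃ ℓ : GradPair N →L[ℂ] ℂ, ∀ p : GradPair N, ℓ p = 0 ↔
      ∫ x in cube N, p.fst x * partialD i φ x = -∫ x in cube N, p.snd i x * φ x := by
  obtain ⟨a, ha⟩ := exists_integral_clm (N := N) (continuous_partialD hφ i)
  obtain ⟨b, hb⟩ := exists_integral_clm (N := N) hφ.continuous
  refine ⟨a.comp (WithLp.fstL 2 ℂ _ _) +
    b.comp ((PiLp.proj 2 (fun _ : Fin N => L2 N) i).comp (WithLp.sndL 2 ℂ _ _)), fun p => ?_⟩
  rw [← ha, ← hb, ← add_eq_zero_iff_eq_neg]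
  rfl

/-- The subspace of the pairs `(u, ∇u)`, the weak gradient being tested against the smooth functions
of a class `T`. -/
def weakGraph (N : ℕ) (T : Set ((Fin N → ℝ) → ℂ)) (hT : ∀ φ ∈ T, ContDiff ℝ ∞ φ) :
    Submodule ℂ (GradPair N) where
  carrier := {p | ∀ φ ∈ T, IsWeakGradAgainst p φ}
  zero_mem' := by
    intro φ hφ i
    obtain ⟨ℓ, hℓ⟩ := exists_weakGrad_clm (hT φ hφ) i
    exact (hℓ _).1 (map_zero ℓ)
  add_mem' := by
    intro p q hp hq φ hφ i
    obtain ⟨ℓ, hℓ⟩ := exists_weakGrad_clm (hT φ hφ) i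
    refine (hℓ _).1 ?_
    rw [map_add, (hℓ _).2 (hp φ hφ i), (hℓ _).2 (hq φ hφ i), add_zero]
  smul_mem' := by
    intro c p hp φ hφ i
    obtain ⟨ℓ, hℓ⟩ := exists_weakGrad_clm (hT φ hφ) i
    refine (hℓ _).1 ?_
    rw [map_smul, (hℓ _).2 (hp φ hφ i), smul_zero]

lemma isClosed_weakGraph (N : ℕ) (T : Set ((Fin N → ℝ) → ℂ)) (hT : ∀ φ ∈ T, ContDiff ℝ ∞ φ) :
    IsClosed (weakGraph N T hT : Set (GradPair N)) := by
  have : (weakGraph N T hT : Set (GradPair N)) =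
      ⋂ (φ) (_ : φ ∈ T) (i : Fin N), {p : GradPair N |
        ∫ x in cube N, p.fst x * partialD i φ x = -∫ x in cube N, p.snd i x * φ x} := by
    ext p
    simp only [Set.mem_iInter]
    rfl
  rw [this]
  refine isClosed_iInter fun φ => isClosed_iInter fun hφ => isClosed_iInter fun i => ?_
  obtain ⟨ℓ, hℓ⟩ := exists_weakGrad_clm (hT φ hφ) i
  simp only [← hℓ]
  exact isClosed_eq ℓ.continuous continuous_const

/-- The Sobolev space `H¹((0,1)^N)`, as the space of pairs `(u, ∇u)`. -/
def H1Cube (N : ℕ) : Submodule ℂ (GradPair N) :=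
  weakGraph N {φ | IsCubeTest φ} fun _ h => h.smooth

/-- The Sobolev space `H¹(T^N)` of the torus, as the space of pairs `(u, ∇u)`. -/
def H1Torus (N : ℕ) : Submodule ℂ (GradPair N) :=
  weakGraph N {φ | IsTorusTest φ} fun _ h => h.smooth

/-- The pairs `(φ, ∇φ)` for test functions `φ` on the open cube. -/
def testGraph (N : ℕ) : Submodule ℂ (GradPair N) where
  carrier := {p | ∃ φ : (Fin N → ℝ) → ℂ, IsCubeTest φ ∧
    p.fst =ᵐ[volume.restrict (cube N)] φ ∧
    ∀ i, p.snd i =ᵐ[volume.restrict (cube N)] partialD i φ}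
  zero_mem' := by
    refine ⟨0, ⟨contDiff_const, HasCompactSupport.zero, ?_⟩, Lp.coeFn_zero _ _ _, fun i => ?_⟩
    · simp [tsupport]
    · refine (Lp.coeFn_zero ℂ 2 (volume.restrict (cube N))).trans (Filter.Eventually.of_forall ?_)
      intro x
      simp [partialD]
  add_mem' := by
    rintro p q ⟨φ, hφ, hp, hp'⟩ ⟨ψ, hψ, hq, hq'⟩
    refine ⟨φ + ψ, ⟨hφ.smooth.add hψ.smooth, hφ.compact.add hψ.compact, ?_⟩, ?_, fun i => ?_⟩
    · exact (tsupport_add φ ψ).trans (Set.union_subset hφ.support hψ.support)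
    · exact (Lp.coeFn_add p.fst q.fst).trans (hp.add hq)
    · refine (Lp.coeFn_add (p.snd i) (q.snd i)).trans (((hp' i).add (hq' i)).trans ?_)
      refine Filter.Eventually.of_forall fun x => ?_
      have h1 := (hφ.smooth.differentiable (by simp)) x
      have h2 := (hψ.smooth.differentiable (by simp)) x
      simp [partialD, fderiv_add h1 h2]
  smul_mem' := by
    rintro c p ⟨φ, hφ, hp, hp'⟩
    refine ⟨c • φ, ⟨hφ.smooth.const_smul c, hφ.compact.smul_left (f := fun _ => c), ?_⟩, ?_,
      fun i => ?_⟩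
    · exact (closure_mono (Function.support_const_smul_subset c φ)).trans hφ.support
    · exact (Lp.coeFn_smul c p.fst).trans (hp.const_smul c)
    · refine (Lp.coeFn_smul c (p.snd i)).trans (((hp' i).const_smul c).trans ?_)
      refine Filter.Eventually.of_forall fun x => ?_
      have h1 := (hφ.smooth.differentiable (by simp)) x
      simp [partialD, fderiv_const_smul h1 c]

/-- `H¹₀((0,1)^N)`: the closure of the test functions in the `H¹` norm. -/
def H10Cube (N : ℕ) : Submodule ℂ (GradPair N) := (testGraph N).topologicalClosure

/-- The elements `u` of a space of Sobolev functions that are weakly harmonic in the cube: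
`∫ ∇u · conj ∇v = 0` for all `v ∈ H¹₀((0,1)^N)`. -/
def weaklyHarmonic {N : ℕ} (X : Submodule ℂ (GradPair N)) : Submodule ℂ X where
  carrier := {u | ∀ v ∈ H10Cube N, ⟪v.snd, u.1.snd⟫_ℂ = 0}
  zero_mem' := by intro v _; simp
  add_mem' := by
    intro p q hp hq v hv
    simp [hp v hv, hq v hv]
  smul_mem' := by
    intro c p hp v hv
    simp [hp v hv]

/-- `Har((0,1)^N)`. -/
def HarCube (N : ℕ) : Submodule ℂ (H1Cube N) := weaklyHarmonic (H1Cube N)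

/-- `Har(T^N)`. -/
def HarTorus (N : ℕ) : Submodule ℂ (H1Torus N) := weaklyHarmonic (H1Torus N)

/-- The map `(u, ∇u) ↦ u` into `L²`. -/
def toL2 {N : ℕ} (X : Submodule ℂ (GradPair N)) : X →ₗ[ℂ] L2 N :=
  (WithLp.fstₗ 2 ℂ (L2 N) (PiLp 2 fun _ : Fin N => L2 N)).comp X.subtype

/-- `V`, the orthogonal complement of `Har((0,1)^N)` in `L²((0,1)^N)`. -/
def V (N : ℕ) : Submodule ℂ (L2 N) := ((HarCube N).map (toL2 (H1Cube N)))ᗮ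

/-- `Ṽ`, the orthogonal complement of `Har(T^N)` in `L²((0,1)^N)`. -/
def Vtilde (N : ℕ) : Submodule ℂ (L2 N) := ((HarTorus N).map (toL2 (H1Torus N)))ᗮ

/-- The antidual `H⁻¹(T^N)` of `H¹(T^N)`, with the dual norm. -/
abbrev DualH1 (N : ℕ) : Type := H1Torus N →L⋆[ℂ] ℂ

/-- The exponential `x ↦ exp (-2πi k·x)`. -/
def expChar {N : ℕ} (k : Fin N → ℤ) (x : Fin N → ℝ) : ℂ :=
  Complex.exp (-(2 * Real.pi * Complex.I) * ∑ j, (k j : ℂ) * (x j : ℂ))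

lemma contDiff_expChar {N : ℕ} (k : Fin N → ℤ) : ContDiff ℝ ∞ (expChar k) := by
  unfold expChar
  refine ContDiff.cexp (contDiff_const.mul (ContDiff.sum fun j _ => contDiff_const.mul ?_))
  exact Complex.ofRealCLM.contDiff.comp (contDiff_apply ℝ ℝ j)

lemma isTorusTest_expChar {N : ℕ} (k : Fin N → ℤ) : IsTorusTest (expChar k) where
  smooth := contDiff_expChar k
  periodic i x := by
    have h : ∑ j, (k j : ℂ) * (((x + Pi.single i (1 : ℝ) : Fin N → ℝ) j : ℝ) : ℂ) =
        ∑ j, (k j : ℂ) * (x j : ℂ) + k i := by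
      have : ∀ j, (k j : ℂ) * (((x + Pi.single i (1 : ℝ) : Fin N → ℝ) j : ℝ) : ℂ) =
          (k j : ℂ) * (x j : ℂ) + (if j = i then (k i : ℂ) else 0) := by
        intro j
        by_cases hj : j = i
        · subst hj; simp [mul_add]
        · simp [hj]
      simp only [this, Finset.sum_add_distrib, Finset.sum_ite_eq', Finset.mem_univ, if_true]
    simp only [expChar, h]
    rw [Complex.exp_eq_exp_iff_exists_int]
    exact ⟨-k i, by push_cast; ring⟩

lemma partialD_expChar {N : ℕ} (k : Fin N → ℤ) (i : Fin N) (x : Fin N → ℝ) :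
    partialD i (expChar k) x = -(2 * Real.pi * Complex.I) * k i * expChar k x := by
  have h1 : HasFDerivAt (fun y : Fin N → ℝ => ∑ j, (k j : ℂ) * (y j : ℂ))
      (∑ j, (k j : ℂ) • (Complex.ofRealCLM.comp (ContinuousLinearMap.proj (R := ℝ) j))) x := by
    refine HasFDerivAt.fun_sum fun j _ => ?_
    exact ((Complex.ofRealCLM.comp
      (ContinuousLinearMap.proj (R := ℝ) (φ := fun _ : Fin N => ℝ) j)).hasFDerivAt).const_mul
        (k j : ℂ)
  have h2 := (h1.const_mul (-(2 * Real.pi * Complex.I))).cexp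
  unfold partialD
  rw [show expChar k = fun y : Fin N → ℝ =>
    Complex.exp (-(2 * Real.pi * Complex.I) * ∑ j, (k j : ℂ) * (y j : ℂ)) from rfl, h2.fderiv]
  have h3 : ∑ j, (k j : ℂ) * (((Pi.single i (1 : ℝ) : Fin N → ℝ) j : ℝ) : ℂ) = k i := by
    rw [Finset.sum_eq_single i] <;> simp +contextual
  simp only [smul_apply, sum_apply,
    ContinuousLinearMap.comp_apply, ContinuousLinearMap.proj_apply, smul_eq_mul,
    Complex.ofRealCLM_apply, h3]
  ring

/-- Parseval's identity on the cube. -/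
lemma hasSum_sq_expChar {N : ℕ} (u : L2 N) :
    HasSum (fun k : Fin N → ℤ => ‖∫ x in cube N, u x * expChar k x‖ ^ 2) (‖u‖ ^ 2) := by
  let _ : MeasureSpace UnitAddCircle := ⟨AddCircle.haarAddCircle⟩
  have : IsProbabilityMeasure (volume : Measure UnitAddCircle) :=
    inferInstanceAs (IsProbabilityMeasure AddCircle.haarAddCircle)
  set e := UnitAddTorus.measurableEquivPiIoc (0 : Fin N → ℝ) with he
  set s : Set (Fin N → ℝ) := {x | ∀ i, x i ∈ Set.Ioc ((0 : Fin N → ℝ) i) ((0 : Fin N → ℝ) i + 1)}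
    with hs
  have hsm : MeasurableSet s := MeasurableSet.univ_pi' fun i => measurableSet_Ioc
  have hsc : volume.restrict s = volume.restrict (cube N) := by
    refine Measure.restrict_congr_set ?_
    have h1 : s = Set.univ.pi fun i : Fin N => Set.Ioc ((0 : Fin N → ℝ) i) ((1 : Fin N → ℝ) i) := by
      ext x; simp [hs]
    have h2 : cube N =
        Set.univ.pi fun i : Fin N => Set.Ioo ((0 : Fin N → ℝ) i) ((1 : Fin N → ℝ) i) := rfl
    rw [h1, h2]
    exact Measure.univ_pi_Ioc_ae_eq_Icc.trans Measure.univ_pi_Ioo_ae_eq_Icc.symm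
  have hg : MeasurePreserving (fun t : UnitAddTorus (Fin N) => ((e t).1 : Fin N → ℝ)) volume
      (volume.restrict (cube N)) := by
    rw [← hsc]
    exact (measurePreserving_subtype_coe hsm).comp
      (UnitAddTorus.measurePreserving_equivPiIoc (0 : Fin N → ℝ))
  have hint : ∀ {E : Type} [NormedAddCommGroup E] [NormedSpace ℝ E] (F : (Fin N → ℝ) → E),
      AEStronglyMeasurable F (volume.restrict (cube N)) →
      ∫ x in cube N, F x = ∫ t : UnitAddTorus (Fin N), F (e t).1 := by
    intro E _ _ F hF
    rw [← hg.map_eq, integral_map hg.aemeasurable]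
    rwa [hg.map_eq]
  have hmem := (Lp.memLp u).comp_measurePreserving hg
  have hcoe := hmem.coeFn_toLp
  have key := UnitAddTorus.hasSum_sq_mFourierCoeff (hmem.toLp _)
  have hnorm : ∫ t, ‖(hmem.toLp _ : UnitAddTorus (Fin N) → ℂ) t‖ ^ 2 = ‖u‖ ^ 2 := by
    have h1 : ∫ t, ‖(hmem.toLp _ : UnitAddTorus (Fin N) → ℂ) t‖ ^ 2 =
        ∫ x in cube N, ‖u x‖ ^ 2 := by
      rw [hint (fun x => ‖u x‖ ^ 2) ((Lp.aestronglyMeasurable u).norm.pow 2)]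
      refine integral_congr_ae ?_
      filter_upwards [hcoe] with t ht
      rw [ht]
      rfl
    rw [h1, ← inner_self_eq_norm_sq (𝕜 := ℂ) u, MeasureTheory.L2.inner_def,
      ← integral_re (L2.integrable_inner u u)]
    simp only [inner_self_eq_norm_sq]
  rw [hnorm] at key
  convert key using 4 with k
  have h2 : ∀ x : Fin N → ℝ,
      UnitAddTorus.mFourier (-k) (fun i => (x i : UnitAddCircle)) = expChar k x := by
    intro x
    simp only [UnitAddTorus.mFourier, ContinuousMap.coe_mk, expChar, fourier_coe_apply,
      ← Complex.exp_sum, Finset.mul_sum]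
    congr 1
    refine Finset.sum_congr rfl fun j _ => ?_
    simp
    ring
  have h3 : ∀ t : UnitAddTorus (Fin N), (fun i => (((e t).1 i : ℝ) : UnitAddCircle)) = t := by
    intro t
    have := e.symm_apply_apply t
    rwa [UnitAddTorus.coe_symm_measurableEquivPiIoc_apply] at this
  unfold UnitAddTorus.mFourierCoeff
  rw [hint (fun x => u x * expChar k x) ((Lp.aestronglyMeasurable u).mul
    (contDiff_expChar k).continuous.aestronglyMeasurable)]
  refine integral_congr_ae ?_
  filter_upwards [hcoe] with t ht
  rw [ht, ← h2, h3, smul_eq_mul, mul_comm]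
  rfl

/-- The mean value as a bounded functional on `L²`. -/
def meanL (N : ℕ) : L2 N →L[ℂ] ℂ :=
  (exists_integral_clm (N := N) (φ := fun _ => 1) continuous_const).choose

lemma meanL_apply {N : ℕ} (u : L2 N) : meanL N u = ∫ x in cube N, u x := by
  have := (exists_integral_clm (N := N) (φ := fun _ => 1) continuous_const).choose_spec u
  simpa [meanL] using this

/-- The Poincaré inequality on the torus. -/
lemma poincare {N : ℕ} (u : GradPair N) (hu : u ∈ H1Torus N) (h0 : ∫ x in cube N, u.fst x = 0) :
    ‖u.fst‖ ^ 2 ≤ ‖u.snd‖ ^ 2 := by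
  have h1 := hasSum_sq_expChar u.fst
  have h2 : HasSum (fun k : Fin N → ℤ =>
      ∑ i, ‖∫ x in cube N, u.snd i x * expChar k x‖ ^ 2) (‖u.snd‖ ^ 2) := by
    rw [PiLp.norm_sq_eq_of_L2]
    exact hasSum_sum fun i _ => hasSum_sq_expChar (u.snd i)
  refine hasSum_le (fun k => ?_) h1 h2
  have h3 : ∀ i, ∫ x in cube N, u.snd i x * expChar k x =
      (2 * Real.pi * Complex.I * k i) * ∫ x in cube N, u.fst x * expChar k x := by
    intro i
    have := hu (expChar k) (isTorusTest_expChar k) i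
    rw [← integral_const_mul, ← neg_inj, ← this, ← integral_neg]
    refine integral_congr_ae (Filter.Eventually.of_forall fun x => ?_)
    simp only [partialD_expChar]
    ring
  by_cases hk : k = 0
  · subst hk
    have : ∫ x in cube N, u.fst x * expChar 0 x = 0 := by simpa [expChar] using h0
    rw [this]
    simp only [norm_zero, ne_eq, OfNat.ofNat_ne_zero, not_false_eq_true, zero_pow]
    positivity
  · obtain ⟨i, hi⟩ := Function.ne_iff.mp hk
    refine le_trans ?_ (Finset.single_le_sum
      (f := fun i => ‖∫ x in cube N, u.snd i x * expChar k x‖ ^ 2)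
      (fun _ _ => by positivity) (Finset.mem_univ i))
    simp only [h3, norm_mul, mul_pow]
    refine le_mul_of_one_le_left (by positivity) ?_
    have hk1 : (1 : ℝ) ≤ ‖(k i : ℂ)‖ ^ 2 := by
      have : (1 : ℤ) ≤ (k i) ^ 2 := by
        have : k i ≠ 0 := hi
        have := sq_pos_of_ne_zero this
        omega
      rw [Complex.norm_intCast, sq_abs]
      exact_mod_cast this
    have hpi : (1 : ℝ) ≤ ‖(Real.pi : ℂ)‖ ^ 2 := by
      rw [Complex.norm_real, Real.norm_eq_abs, sq_abs]
      nlinarith [Real.pi_gt_three]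
    simp only [Complex.norm_I, Complex.norm_ofNat]
    nlinarith

/-- The integral over the cube of a partial derivative of a periodic function vanishes. -/
lemma integral_partialD {N : ℕ} {φ : (Fin N → ℝ) → ℂ} (hφ : IsTorusTest φ) (i : Fin N) :
    ∫ x in cube N, partialD i φ x = 0 := by
  have h0 : Measure.restrict volume (cube N) =
      volume.restrict (Set.Icc (0 : Fin N → ℝ) 1) :=
    Measure.restrict_congr_set Measure.univ_pi_Ioo_ae_eq_Icc
  rw [h0]
  cases N with
  | zero => exact i.elim0
  | succ n =>
    have hd : Differentiable ℝ φ := hφ.smooth.differentiable (by simp)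
    have hsum : ∀ x, ∑ j, (if j = i then fderiv ℝ φ x else 0) (Pi.single j 1) = partialD i φ x := by
      intro x
      rw [Finset.sum_eq_single i] <;> simp +contextual [partialD]
    have key := integral_divergence_of_hasFDerivAt_off_countable' (0 : Fin (n + 1) → ℝ) 1
      (fun j => by simp) (fun j x => if j = i then φ x else 0)
      (fun j x => if j = i then fderiv ℝ φ x else 0) ∅ Set.countable_empty
      (fun j => by
        by_cases hj : j = i
        · simpa [hj] using hd.continuous.continuousOn
        · simpa [hj] using continuousOn_const)
      (fun x _ j => by
        by_cases hj : j = i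
        · simpa [hj] using (hd x).hasFDerivAt
        · simpa [hj] using hasFDerivAt_const (0 : ℂ) x)
      (by
        simp only [hsum]
        exact (continuous_partialD hφ.smooth i).continuousOn.integrableOn_compact isCompact_Icc)
    simp only [hsum] at key
    rw [key]
    refine Finset.sum_eq_zero fun j _ => ?_
    by_cases hj : j = i
    · subst hj
      simp only [if_true, sub_eq_zero]
      congr 1
      ext x
      refine Eq.trans ?_ (hφ.periodic j _)
      congr 1
      ext l
      rcases Fin.eq_self_or_eq_succAbove j l with rfl | ⟨m, rfl⟩ <;> simp
    · simp [hj]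

/-- The constant function `1`, with gradient `0`, as an element of `H¹(T^N)`. -/
def one (N : ℕ) : H1Torus N :=
  ⟨WithLp.toLp 2 ((memLp_of_continuous (N := N) (φ := fun _ => 1) continuous_const).toLp _, 0), by
    intro φ hφ i
    have h1 : ∫ x in cube N, ((memLp_of_continuous (N := N) (φ := fun _ => 1)
        continuous_const).toLp _ : (Fin N → ℝ) → ℂ) x * partialD i φ x = 0 := by
      rw [← integral_partialD hφ i]
      refine integral_congr_ae ?_
      filter_upwards [(memLp_of_continuous (N := N) (φ := fun _ => 1)
        continuous_const).coeFn_toLp] with x hx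
      rw [hx, one_mul]
    have h2 : ∫ x in cube N, (0 : L2 N) x * φ x = 0 := by
      rw [← integral_zero (Fin N → ℝ) ℂ (μ := volume.restrict (cube N))]
      refine integral_congr_ae ?_
      filter_upwards [Lp.coeFn_zero ℂ 2 (volume.restrict (cube N))] with x hx
      rw [hx]
      simp
    change _ = -∫ x in cube N, (0 : L2 N) x * φ x
    rw [h2, neg_zero]
    exact h1⟩

/-- The moment of order zero `μ₀(f) = ⟨f, 1⟩`. -/
def mu0 {N : ℕ} (f : DualH1 N) : ℂ := f (one N)

/-- `u = u_f`: `u ∈ H¹(T^N)` has mean zero and `div ∇u = f - μ₀(f)` in `H⁻¹(T^N)`, i.e.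
`∫ ∇u · conj ∇v = -⟨f - μ₀(f), v⟩` for all `v ∈ H¹(T^N)`. -/
def IsPotential {N : ℕ} (f : DualH1 N) (u : H1Torus N) : Prop :=
  ∫ x in cube N, u.1.fst x = 0 ∧
    ∀ v : H1Torus N, ⟪v.1.snd, u.1.snd⟫_ℂ = -(f v - mu0 f * ∫ x in cube N, conj (v.1.fst x))

instance (N : ℕ) : CompleteSpace (H1Torus N) :=
  (isClosed_weakGraph N _ _).completeSpace_coe

/-- The mean value on `H¹(T^N)`. -/
def meanH (N : ℕ) : H1Torus N →L[ℂ] ℂ :=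
  (meanL N).comp ((WithLp.fstL 2 ℂ _ _).comp (H1Torus N).subtypeL)

lemma meanH_apply {N : ℕ} (u : H1Torus N) : meanH N u = ∫ x in cube N, u.1.fst x :=
  meanL_apply u.1.fst

/-- The gradient on `H¹(T^N)`. -/
def gradH (N : ℕ) : H1Torus N →L[ℂ] PiLp 2 (fun _ : Fin N => L2 N) :=
  (WithLp.sndL 2 ℂ _ _).comp (H1Torus N).subtypeL

lemma gradH_apply {N : ℕ} (u : H1Torus N) : gradH N u = u.1.snd := rfl

lemma gradH_one (N : ℕ) : gradH N (one N) = 0 := rfl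

lemma meanH_one (N : ℕ) : meanH N (one N) = 1 := by
  rw [meanH_apply]
  have h1 : ∫ x in cube N, (one N).1.fst x = ∫ x in cube N, (1 : ℂ) := by
    refine integral_congr_ae ?_
    exact (memLp_of_continuous (N := N) (φ := fun _ => 1) continuous_const).coeFn_toLp
  have h2 : volume (cube N) = 1 := by
    rw [cube, Real.volume_pi_Ioo]
    simp
  rw [h1]
  simp [measureReal_def, h2]

lemma isPotential_iff {N : ℕ} (f : DualH1 N) (u : H1Torus N) : IsPotential f u ↔
    meanH N u = 0 ∧
      ∀ v : H1Torus N, ⟪gradH N v, gradH N u⟫_ℂ = -(f v - mu0 f * conj (meanH N v)) := by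
  simp only [IsPotential, meanH_apply, gradH_apply, integral_conj]

lemma norm_sq_le {N : ℕ} (u : H1Torus N) (hu : meanH N u = 0) :
    ‖u‖ ^ 2 ≤ 2 * ‖gradH N u‖ ^ 2 := by
  have h1 : ‖u‖ ^ 2 = ‖u.1.fst‖ ^ 2 + ‖u.1.snd‖ ^ 2 := by
    rw [← WithLp.prod_norm_sq_eq_of_L2]
    rfl
  have h2 := poincare u.1 u.2 (by rwa [← meanH_apply])
  rw [h1, gradH_apply]
  linarith

/-- Riesz representation on the kernel of a functional, for a coercive Hermitian form. -/
lemma exists_riesz {E F : Type*} [NormedAddCommGroup E] [InnerProductSpace ℂ E] [CompleteSpace E]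
    [NormedAddCommGroup F] [InnerProductSpace ℂ F] [CompleteSpace F] (m : E →L[ℂ] ℂ) (G : E →L[ℂ] F)
    (hG : ∀ u, m u = 0 → ‖u‖ ^ 2 ≤ 2 * ‖G u‖ ^ 2) (f : E →L⋆[ℂ] ℂ) :
    ∃ u, m u = 0 ∧ ∀ v, m v = 0 → ⟪G v, G u⟫_ℂ = -f v := by
  let K : Submodule ℂ E := m.ker
  have hK : IsClosed (K : Set E) := m.isClosed_ker
  have : CompleteSpace K := hK.completeSpace_coe
  let D : K →L[ℂ] F := G.comp K.subtypeL
  let A : K →L[ℂ] K := (ContinuousLinearMap.adjoint D).comp D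
  have hA : ∀ u v : K, ⟪v, A u⟫_ℂ = ⟪G v, G u⟫_ℂ := fun u v =>
    ContinuousLinearMap.adjoint_inner_right D v (D u)
  have hunit : IsUnit A := by
    refine ContinuousLinearMap.isUnit_of_forall_le_norm_inner_map A (c := 1 / 2) (by norm_num) ?_
    intro u
    rw [norm_inner_symm, hA, inner_self_eq_norm_sq_to_K]
    have := hG (u : E) u.2
    have h2 : ‖u‖ = ‖(u : E)‖ := rfl
    rw [h2]
    simp only [norm_pow, RCLike.norm_ofReal, abs_norm]
    push_cast
    linarith
  have hsurj : Function.Surjective A := (ContinuousLinearMap.isUnit_iff_bijective.1 hunit).2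
  let g : K →L[ℂ] ℂ := (starL ℂ : ℂ ≃L⋆[ℂ] ℂ).toContinuousLinearMap.comp (-(f.comp K.subtypeL))
  obtain ⟨u, hu⟩ := hsurj ((InnerProductSpace.toDual ℂ K).symm g)
  refine ⟨u, u.2, fun v hv => ?_⟩
  have h1 := hA u ⟨v, hv⟩
  rw [← h1, hu, ← inner_conj_symm, InnerProductSpace.toDual_symm_apply]
  simp [g]

/-- Existence and uniqueness of `u_f`. -/
lemma existsUnique_potential {N : ℕ} (f : DualH1 N) : ∃! u : H1Torus N, IsPotential f u := by
  simp only [isPotential_iff]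
  obtain ⟨u, hu0, hu'⟩ := exists_riesz (E := H1Torus N) (F := PiLp 2 (fun _ : Fin N => L2 N)) (meanH N) (gradH N)
    norm_sq_le f
  refine ⟨u, ⟨hu0, fun v => ?_⟩, ?_⟩
  · have hv : meanH N (v - meanH N v • one N) = 0 := by simp [meanH_one]
    have h := hu' _ hv
    simp only [map_sub, map_smul, gradH_one, smul_zero, sub_zero, map_smulₛₗ] at h
    rw [h, mu0]
    simp [mul_comm]
  · rintro w ⟨hw0, hw⟩
    have hz : meanH N (w - u) = 0 := by
      rw [map_sub, hw0, hu0, sub_zero]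
    have hgz : gradH N (w - u) = 0 := by
      have h1 := hu' _ hz
      have h2 := hw (w - u)
      rw [hz, map_zero, mul_zero, sub_zero] at h2
      rw [← inner_self_eq_zero (𝕜 := ℂ)]
      conv_lhs => rw [map_sub (gradH N) w u, inner_sub_right, ← map_sub]
      rw [h2, h1]
      simp
    have h3 := norm_sq_le _ hz
    rw [hgz] at h3
    have h4 : ‖w - u‖ ^ 2 = 0 := le_antisymm (by simpa using h3) (by positivity)
    exact sub_eq_zero.1 (norm_eq_zero.1 ((pow_eq_zero_iff two_ne_zero).1 h4))

/-- The function `u_f`. -/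
def potential {N : ℕ} (f : DualH1 N) : H1Torus N := (existsUnique_potential f).choose

lemma isPotential_potential {N : ℕ} (f : DualH1 N) : IsPotential f (potential f) :=
  (existsUnique_potential f).choose_spec.1

lemma potential_eq {N : ℕ} {f : DualH1 N} {u : H1Torus N} (h : IsPotential f u) :
    potential f = u :=
  (existsUnique_potential f).unique (isPotential_potential f) h

lemma potential_add {N : ℕ} (f g : DualH1 N) :
    potential (f + g) = potential f + potential g := by
  have hf := (isPotential_iff _ _).1 (isPotential_potential f)
  have hg := (isPotential_iff _ _).1 (isPotential_potential g)
  refine potential_eq ((isPotential_iff _ _).2 ⟨by rw [map_add, hf.1, hg.1, add_zero], ?_⟩)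
  intro v
  rw [map_add, inner_add_right, hf.2, hg.2]
  simp only [mu0, add_apply]
  ring

lemma potential_smul {N : ℕ} (c : ℂ) (f : DualH1 N) :
    potential (c • f) = c • potential f := by
  have hf := (isPotential_iff _ _).1 (isPotential_potential f)
  refine potential_eq ((isPotential_iff _ _).2 ⟨by rw [map_smul, hf.1, smul_zero], ?_⟩)
  intro v
  rw [map_smul, inner_smul_right, hf.2]
  simp only [mu0, smul_apply, smul_eq_mul]
  ring

/-- `H⁻¹(T^N)` with the inner product `(∇u_f | ∇u_g) + μ₀(f) conj μ₀(g)`, as opposed to `DualH1 N`,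
which carries the dual norm. -/
def HNegOne (N : ℕ) : Type := DualH1 N

instance (N : ℕ) : AddCommGroup (HNegOne N) := inferInstanceAs (AddCommGroup (DualH1 N))

instance (N : ℕ) : Module ℂ (HNegOne N) := inferInstanceAs (Module ℂ (DualH1 N))

/-- The identity map, from `H⁻¹(T^N)` with the inner product above to `H⁻¹(T^N)` with the dual
norm. -/
def toDualH1 (N : ℕ) : HNegOne N ≃ₗ[ℂ] DualH1 N := LinearEquiv.refl ℂ (DualH1 N)

/-- The inner product `(∇u_f | ∇u_g) + μ₀(f) conj μ₀(g)` of `H⁻¹(T^N)`; Mathlib's inner products are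
linear in the second argument, so that `inner f g` is this expression with `f` and `g` swapped. -/
@[reducible] def negOneCore (N : ℕ) : InnerProductSpace.Core ℂ (HNegOne N) where
  inner f g :=
    ⟪(potential (toDualH1 N f)).1.snd, (potential (toDualH1 N g)).1.snd⟫_ℂ +
      conj (mu0 (toDualH1 N f)) * mu0 (toDualH1 N g)
  conj_inner_symm f g := by
    rw [map_add, inner_conj_symm, map_mul, RCLike.conj_conj, mul_comm]
  re_inner_nonneg f := by
    rw [map_add, ← RCLike.inner_apply']
    exact add_nonneg inner_self_nonneg inner_self_nonneg
  add_left f g h := by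
    change ⟪gradH N (potential (toDualH1 N f + toDualH1 N g)), gradH N _⟫_ℂ +
      conj (mu0 (toDualH1 N f) + mu0 (toDualH1 N g)) * _ =
      (⟪gradH N _, gradH N _⟫_ℂ + _) + (⟪gradH N _, gradH N _⟫_ℂ + _)
    rw [potential_add, map_add (gradH N), inner_add_left, map_add]
    ring
  smul_left f g c := by
    change ⟪gradH N (potential (c • toDualH1 N f)), gradH N _⟫_ℂ +
      conj (c * mu0 (toDualH1 N f)) * _ = _ * (⟪gradH N _, gradH N _⟫_ℂ + _)
    rw [potential_smul, map_smul (gradH N), inner_smul_left, map_mul]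
    ring
  definite f hf := by
    have h0 : RCLike.re (⟪gradH N (potential (toDualH1 N f)), gradH N (potential (toDualH1 N f))⟫_ℂ +
      conj (mu0 (toDualH1 N f)) * mu0 (toDualH1 N f)) = RCLike.re (0 : ℂ) := congrArg _ hf
    rw [map_add, map_zero, inner_self_eq_norm_sq, RCLike.conj_mul] at h0
    norm_cast at h0
    have h3 : gradH N (potential (toDualH1 N f)) = 0 := by
      rw [← norm_eq_zero, ← sq_eq_zero_iff]
      nlinarith [sq_nonneg ‖gradH N (potential (toDualH1 N f))‖, sq_nonneg ‖mu0 (toDualH1 N f)‖]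
    have h4 : mu0 (toDualH1 N f) = 0 := by
      rw [← norm_eq_zero, ← sq_eq_zero_iff]
      nlinarith [sq_nonneg ‖gradH N (potential (toDualH1 N f))‖, sq_nonneg ‖mu0 (toDualH1 N f)‖]
    have h5 := ((isPotential_iff _ _).1 (isPotential_potential (toDualH1 N f))).2
    rw [h3, h4] at h5
    refine (toDualH1 N).injective (ContinuousLinearMap.ext fun v => ?_)
    simpa using h5 v

instance (N : ℕ) : NormedAddCommGroup (HNegOne N) :=
  @InnerProductSpace.Core.toNormedAddCommGroup ℂ (HNegOne N) _ _ _ (negOneCore N)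

instance (N : ℕ) : InnerProductSpace ℂ (HNegOne N) :=
  InnerProductSpace.ofCore (negOneCore N).toCore

/-- `H`, the annihilator of `Har(T^N)` in `H⁻¹(T^N)`, with the inner product of `HNegOne N`. -/
def H (N : ℕ) : Submodule ℂ (HNegOne N) where
  carrier := {w | ∀ v ∈ HarTorus N, toDualH1 N w v = 0}
  zero_mem' := by intro v _; simp
  add_mem' := by
    intro p q hp hq v hv
    simp [hp v hv, hq v hv]
  smul_mem' := by
    intro c p hp v hv
    simp [hp v hv]

/-- A subspace `W` of `L²((0,1)^N)` is densely and compactly embedded in `H`: identifying `f` with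
the functional `v ↦ ∫ f conj v` gives a well-defined injective continuous linear map from `W`, with
the `L²` norm, into `H`, and this map is compact and has dense range. -/
def DenselyCompactlyEmbeddedInH {N : ℕ} (W : Submodule ℂ (L2 N)) : Prop :=
  ∃ j : W →L[ℂ] H N,
    (∀ (f : W) (v : H1Torus N),
      toDualH1 N (j f) v = ∫ x in cube N, (f : L2 N) x * conj (v.1.fst x)) ∧
    Function.Injective j ∧ DenseRange j ∧ IsCompactOperator j

end

end MomentHeat

namespace MomentHeat

/-! Let `T` be the inclusion of `H¹(T^N)` into `L²`. The functional attached to `f` is `v ↦ ⟪T v, f⟫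
= ⟪v, T* f⟫`, the second inner product being that of `H¹`. Up to the Riesz isomorphism of `H¹(T^N)`
with its antidual, the embedding of `W` is therefore `T*` restricted to `W`, and every claim about
it is a claim about `T` (`exists_dense_compact_embedding`).

Injectivity holds because the range of `T` contains the exponentials and so is dense. Compactness is
Rellich's theorem: the Fourier coefficients of an `H¹` function are square summable with weight
`|2πk|²`, which tends to infinity (`isCompactOperator_adjoint_of_weighted`). The values lie in `H`
as soon as `W ≤ Ṽ`. The Riesz isomorphism carries `Har(T^N)ᗮ` to `H`, so the range is dense in `H`
once every `u ∈ H¹(T^N)` with `T u ⊥ W` belongs to `Har(T^N)`.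

This last point holds whenever `V ≤ W`. By Green's formula, `u` is weakly harmonic iff it is
`L²`-orthogonal to `Δφ` for all test functions `φ` on the cube (`mem_weaklyHarmonic_iff`). Hence
each `Δφ` lies in `V`, and `u ⊥ V` forces `u` to be harmonic. Moreover `V ≤ Ṽ`, since periodizing
test functions gives `H¹(T^N) ⊆ H¹(Q)`. Both cases are thus instances of one statement about spaces
between `V` and `Ṽ`.

The equivalence of the norms comes from the equation of `u_f`, used directly in one direction and
tested with `u_f` itself, together with Poincaré's inequality, in the other. -/

/-! ### Periodization of test functions and the inclusion of `H¹(T^N)` in `H¹(Q)` -/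

theorem contDiff_finsum {ι E F : Type*} [NormedAddCommGroup E] [NormedSpace ℝ E]
    [NormedAddCommGroup F] [NormedSpace ℝ F] {n : WithTop ℕ∞} {f : ι → E → F}
    (hf : ∀ i, ContDiff ℝ n (f i)) (hloc : LocallyFinite fun i => Function.support (f i)) :
    ContDiff ℝ n fun x => ∑ᶠ i, f i x := by
  rw [contDiff_iff_contDiffAt]
  intro x
  obtain ⟨s, hs⟩ := hloc.exists_finset_support x
  refine ContDiffAt.congr_of_eventuallyEq (f := fun y => ∑ i ∈ s, f i y)
    (ContDiff.sum fun i _ => hf i).contDiffAt ?_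
  filter_upwards [hs] with y hy
  exact finsum_eq_sum_of_support_subset _ hy

theorem isOpen_cube (N : ℕ) : IsOpen (cube N) :=
  isOpen_set_pi Set.finite_univ fun _ _ => isOpen_Ioo

theorem mem_cube {N : ℕ} {x : Fin N → ℝ} : x ∈ cube N ↔ ∀ i, 0 < x i ∧ x i < 1 := by
  simp [cube]

theorem IsCubeTest.eq_zero {N : ℕ} {φ : (Fin N → ℝ) → ℂ} (hφ : IsCubeTest φ) {x : Fin N → ℝ}
    (hx : x ∉ cube N) : φ x = 0 :=
  image_eq_zero_of_notMem_tsupport fun h => hx (hφ.support h)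

/-- The periodic extension of a function on the cube. -/
noncomputable def periodize {N : ℕ} (φ : (Fin N → ℝ) → ℂ) (x : Fin N → ℝ) : ℂ :=
  ∑ᶠ k : Fin N → ℤ, φ (x + fun i => (k i : ℝ))

theorem IsCubeTest.isTorusTest_periodize {N : ℕ} {φ : (Fin N → ℝ) → ℂ} (hφ : IsCubeTest φ) :
    IsTorusTest (periodize φ) where
  smooth := by
    refine contDiff_finsum (fun k => hφ.smooth.comp (contDiff_id.add contDiff_const)) ?_
    intro x
    refine ⟨Metric.ball x 1, Metric.ball_mem_nhds x one_pos, ?_⟩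
    -- If `y` is within distance `1` of `x` and `y + k` is in the cube, then `-x i - 1 < k i < -x i
    -- + 2`: only finitely many translates matter near `x`.
    refine (Set.finite_Icc (fun i => ⌊-x i⌋ - 2 : Fin N → ℤ) (fun i => ⌈-x i⌉ + 2)).subset ?_
    rintro k ⟨y, hy, hyx⟩
    have hc : (y + fun i => (k i : ℝ)) ∈ cube N := by
      by_contra h
      exact hy (hφ.eq_zero h)
    rw [mem_cube] at hc
    have hd : ∀ i, |y i - x i| < 1 := fun i => by
      rw [← Real.dist_eq]
      exact (dist_le_pi_dist y x i).trans_lt hyx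
    simp only [Pi.add_apply] at hc
    refine ⟨fun i => ?_, fun i => ?_⟩
    · have h1 := abs_lt.1 (hd i)
      have h2 := hc i
      have h3 := Int.floor_le (-x i)
      have : ((⌊-x i⌋ - 2 : ℤ) : ℝ) ≤ k i := by push_cast; linarith
      exact_mod_cast this
    · have h1 := abs_lt.1 (hd i)
      have h2 := hc i
      have h3 := Int.le_ceil (-x i)
      have : (k i : ℝ) ≤ ((⌈-x i⌉ + 2 : ℤ) : ℝ) := by push_cast; linarith
      exact_mod_cast this
  periodic i x := by
    unfold periodize
    rw [← finsum_comp_equiv (Equiv.subRight (Pi.single i 1 : Fin N → ℤ))]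
    refine finsum_congr fun k => ?_
    congr 1
    ext j
    by_cases hj : j = i
    · subst hj; simp
    · simp [hj]

/-- Two points of the open unit cube cannot differ by a nonzero integer vector, so only the term `k
= 0` survives. -/
theorem periodize_eq {N : ℕ} {φ : (Fin N → ℝ) → ℂ} (hφ : IsCubeTest φ) {x : Fin N → ℝ}
    (hx : x ∈ cube N) : periodize φ x = φ x := by
  unfold periodize
  rw [finsum_eq_single _ 0]
  · congr 1
    ext i
    simp
  · intro k hk
    refine hφ.eq_zero fun h => hk ?_
    rw [mem_cube] at h hx
    ext i
    have h1 := h i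
    have h2 := hx i
    simp only [Pi.add_apply] at h1
    have h3 : (-1 : ℝ) < k i := by linarith
    have h4 : (k i : ℝ) < 1 := by linarith
    have h5 : -1 < k i := by exact_mod_cast h3
    have h6 : k i < 1 := by exact_mod_cast h4
    simp only [Pi.zero_apply]
    omega

theorem partialD_periodize {N : ℕ} {φ : (Fin N → ℝ) → ℂ} (hφ : IsCubeTest φ) (i : Fin N)
    {x : Fin N → ℝ} (hx : x ∈ cube N) : partialD i (periodize φ) x = partialD i φ x := by
  have : periodize φ =ᶠ[nhds x] φ := by
    filter_upwards [(isOpen_cube N).mem_nhds hx] with y hy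
    exact periodize_eq hφ hy
  rw [partialD, partialD, this.fderiv_eq]

/-- The periodization of a cube test function is a torus test function with the same values and
derivatives on the cube, so the torus condition contains the cube condition. -/
theorem H1Torus_le_H1Cube (N : ℕ) : H1Torus N ≤ H1Cube N := by
  intro p hp φ hφ i
  have h := hp _ (IsCubeTest.isTorusTest_periodize hφ) i
  have hm : MeasurableSet (cube N) := (isOpen_cube N).measurableSet
  have h1 : ∫ x in cube N, p.fst x * partialD i (periodize φ) x =
      ∫ x in cube N, p.fst x * partialD i φ x :=
    setIntegral_congr_fun hm fun x hx => by simp only [partialD_periodize hφ i hx]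
  have h2 : ∫ x in cube N, p.snd i x * periodize φ x = ∫ x in cube N, p.snd i x * φ x :=
    setIntegral_congr_fun hm fun x hx => by simp only [periodize_eq hφ hx]
  rw [← h1, ← h2, h]

/-! ### Derivatives of test functions -/

theorem partialD_conj {N : ℕ} {φ : (Fin N → ℝ) → ℂ} (hφ : ContDiff ℝ ∞ φ) (i : Fin N)
    (x : Fin N → ℝ) : partialD i (fun y => conj (φ y)) x = conj (partialD i φ x) := by
  have h := ((Complex.conjCLE : ℂ →L[ℝ] ℂ).hasFDerivAt (x := φ x)).comp x
    ((hφ.differentiable (by simp)) x).hasFDerivAt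
  have h' : HasFDerivAt (fun y => conj (φ y)) ((Complex.conjCLE : ℂ →L[ℝ] ℂ).comp (fderiv ℝ φ x))
    x := h
  rw [partialD, h'.fderiv]
  rfl

theorem partialD_mul {N : ℕ} {φ ψ : (Fin N → ℝ) → ℂ} (hφ : ContDiff ℝ ∞ φ) (hψ : ContDiff ℝ ∞ ψ)
    (i : Fin N) (x : Fin N → ℝ) :
    partialD i (fun y => φ y * ψ y) x = φ x * partialD i ψ x + partialD i φ x * ψ x := by
  have h := ((hφ.differentiable (by simp)) x).hasFDerivAt.mul
    ((hψ.differentiable (by simp)) x).hasFDerivAt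
  have h' : HasFDerivAt (fun y => φ y * ψ y) (φ x • fderiv ℝ ψ x + ψ x • fderiv ℝ φ x) x := h
  rw [partialD, h'.fderiv]
  simp [partialD, mul_comm]

theorem contDiff_partialD {N : ℕ} {φ : (Fin N → ℝ) → ℂ} (hφ : ContDiff ℝ ∞ φ) (i : Fin N) :
    ContDiff ℝ ∞ (partialD i φ) :=
  (hφ.fderiv_right (m := ∞) (by simp)).clm_apply contDiff_const

theorem contDiff_conj {N : ℕ} {φ : (Fin N → ℝ) → ℂ} (hφ : ContDiff ℝ ∞ φ) :
    ContDiff ℝ ∞ fun y => conj (φ y) :=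
  (Complex.conjCLE : ℂ →L[ℝ] ℂ).contDiff.comp hφ

theorem IsCubeTest.conj {N : ℕ} {φ : (Fin N → ℝ) → ℂ} (hφ : IsCubeTest φ) :
    IsCubeTest fun y => conj (φ y) where
  smooth := contDiff_conj hφ.smooth
  compact := hφ.compact.comp_left (g := fun z : ℂ => (starRingEnd ℂ) z) (map_zero _)
  support := (tsupport_comp_subset (g := fun z : ℂ => (starRingEnd ℂ) z) (map_zero _) φ).trans
    hφ.support

theorem IsCubeTest.partialD {N : ℕ} {φ : (Fin N → ℝ) → ℂ} (hφ : IsCubeTest φ) (i : Fin N) :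
    IsCubeTest (partialD i φ) where
  smooth := contDiff_partialD hφ.smooth i
  compact := hφ.compact.fderiv_apply ℝ _
  support := (tsupport_fderiv_apply_subset ℝ _).trans hφ.support

theorem IsTorusTest.mul {N : ℕ} {φ ψ : (Fin N → ℝ) → ℂ} (hφ : IsTorusTest φ)
    (hψ : IsTorusTest ψ) : IsTorusTest fun y => φ y * ψ y where
  smooth := hφ.smooth.mul hψ.smooth
  periodic i x := by rw [hφ.periodic, hψ.periodic]

theorem IsTorusTest.conj {N : ℕ} {φ : (Fin N → ℝ) → ℂ} (hφ : IsTorusTest φ) :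
    IsTorusTest fun y => conj (φ y) where
  smooth := contDiff_conj hφ.smooth
  periodic i x := by rw [hφ.periodic]

/-! ### Smooth functions as Sobolev pairs -/

/-- The class of a continuous function in `L²` of the cube. -/
noncomputable def contL2 {N : ℕ} (φ : (Fin N → ℝ) → ℂ) (hφ : Continuous φ) : L2 N :=
  (memLp_of_continuous hφ).toLp φ

theorem contL2_ae {N : ℕ} {φ : (Fin N → ℝ) → ℂ} (hφ : Continuous φ) :
    contL2 φ hφ =ᵐ[volume.restrict (cube N)] φ :=
  (memLp_of_continuous hφ).coeFn_toLp

/-- The pair `(φ, ∇φ)` of a smooth function `φ`. -/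
noncomputable def smoothPair {N : ℕ} (φ : (Fin N → ℝ) → ℂ) (hφ : ContDiff ℝ ∞ φ) : GradPair N :=
  WithLp.toLp 2 (contL2 φ hφ.continuous,
    WithLp.toLp 2 fun i => contL2 (partialD i φ) (continuous_partialD hφ i))

theorem integrableOn_of_continuous {N : ℕ} {φ : (Fin N → ℝ) → ℂ} (hφ : Continuous φ) :
    IntegrableOn φ (cube N) := by
  refine (hφ.continuousOn.integrableOn_compact (isCompact_Icc (a := 0) (b := 1))).mono_set ?_
  intro x hx
  rw [mem_cube] at hx
  exact ⟨fun i => (hx i).1.le, fun i => (hx i).2.le⟩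

/-- Integration by parts without boundary terms: the product of two periodic functions is periodic,
so its partial derivatives have integral zero. -/
theorem smoothPair_mem_H1Torus {N : ℕ} {φ : (Fin N → ℝ) → ℂ} (hφ : IsTorusTest φ) :
    smoothPair φ hφ.smooth ∈ H1Torus N := by
  intro ψ hψ i
  have h := integral_partialD (hφ.mul hψ) i
  simp only [partialD_mul hφ.smooth hψ.smooth] at h
  rw [integral_add (f := fun x => φ x * partialD i ψ x) (g := fun x => partialD i φ x * ψ x) (integrableOn_of_continuous
      (hφ.smooth.continuous.mul (continuous_partialD hψ.smooth i)))
    (integrableOn_of_continuous ((continuous_partialD hφ.smooth i).mul hψ.smooth.continuous)),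
    add_eq_zero_iff_eq_neg] at h
  have h1 : ∫ x in cube N, (smoothPair φ hφ.smooth).fst x * partialD i ψ x =
      ∫ x in cube N, φ x * partialD i ψ x := by
    refine integral_congr_ae ?_
    filter_upwards [contL2_ae hφ.smooth.continuous] with x hx
    rw [← hx]
    rfl
  have h2 : ∫ x in cube N, (smoothPair φ hφ.smooth).snd i x * ψ x =
      ∫ x in cube N, partialD i φ x * ψ x := by
    refine integral_congr_ae ?_
    filter_upwards [contL2_ae (continuous_partialD hφ.smooth i)] with x hx
    rw [← hx]
    rfl
  rw [h1, h2, h]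

/-! ### Weakly harmonic functions -/

theorem inner_contL2 {N : ℕ} {φ : (Fin N → ℝ) → ℂ} (hφ : Continuous φ) (u : L2 N) :
    ⟪contL2 φ hφ, u⟫_ℂ = ∫ x in cube N, u x * conj (φ x) := by
  rw [MeasureTheory.L2.inner_def]
  refine integral_congr_ae ?_
  filter_upwards [contL2_ae hφ] with x hx
  rw [hx, RCLike.inner_apply]

/-- The Laplacian of a smooth function, as an element of `L²` of the cube. -/
noncomputable def laplaceL2 {N : ℕ} (φ : (Fin N → ℝ) → ℂ) (hφ : ContDiff ℝ ∞ φ) : L2 N :=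
  ∑ i, contL2 (partialD i (partialD i φ)) (continuous_partialD (contDiff_partialD hφ i) i)

/-- Green's formula for Sobolev functions against test functions. -/
theorem inner_smoothPair_snd {N : ℕ} {p : GradPair N} (hp : p ∈ H1Cube N) {φ : (Fin N → ℝ) → ℂ}
    (hφ : IsCubeTest φ) :
    ⟪(smoothPair φ hφ.smooth).snd, p.snd⟫_ℂ = -⟪laplaceL2 φ hφ.smooth, p.fst⟫_ℂ := by
  rw [PiLp.inner_apply, laplaceL2, sum_inner, ← Finset.sum_neg_distrib]
  refine Finset.sum_congr rfl fun i _ => ?_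
  -- The inner product conjugates its first argument, so the weak gradient is tested against the
  -- conjugate of `∂ᵢφ`.
  have h := hp _ (hφ.partialD i).conj i
  change ⟪contL2 (partialD i φ) (continuous_partialD hφ.smooth i), p.snd i⟫_ℂ = _
  rw [inner_contL2, inner_contL2, ← neg_eq_iff_eq_neg, ← h]
  simp only [partialD_conj (hφ.partialD i).smooth]

theorem mem_testGraph_iff {N : ℕ} {p : GradPair N} :
    p ∈ testGraph N ↔ ∃ (φ : (Fin N → ℝ) → ℂ) (hφ : IsCubeTest φ), p = smoothPair φ hφ.smooth := by
  constructor
  · rintro ⟨φ, hφ, h1, h2⟩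
    refine ⟨φ, hφ, (WithLp.ofLp_injective 2) (Prod.ext ?_ ?_)⟩
    · exact Lp.ext (h1.trans (contL2_ae hφ.smooth.continuous).symm)
    · ext1 i
      exact Lp.ext ((h2 i).trans (contL2_ae (continuous_partialD hφ.smooth i)).symm)
  · rintro ⟨φ, hφ, rfl⟩
    exact ⟨φ, hφ, contL2_ae hφ.smooth.continuous,
      fun i => contL2_ae (continuous_partialD hφ.smooth i)⟩

/-- Green's formula moves both derivatives onto `φ`, and the condition on `v` is closed, so it
passes from test functions to `H¹₀`. Weak harmonicity thereby becomes an orthogonality relation in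
`L²` that no longer involves the gradient of `u`. -/
theorem mem_weaklyHarmonic_iff {N : ℕ} {X : Submodule ℂ (GradPair N)} (hX : X ≤ H1Cube N) {u : X} :
    u ∈ weaklyHarmonic X ↔ ∀ (φ : (Fin N → ℝ) → ℂ) (hφ : IsCubeTest φ),
      ⟪laplaceL2 φ hφ.smooth, u.1.fst⟫_ℂ = 0 := by
  constructor
  · intro hu φ hφ
    have h := hu _ (Submodule.le_topologicalClosure _ (mem_testGraph_iff.2 ⟨φ, hφ, rfl⟩))
    rwa [inner_smoothPair_snd (hX u.2) hφ, neg_eq_zero] at h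
  · intro h v hv
    have hc : IsClosed {v : GradPair N | ⟪v.snd, u.1.snd⟫_ℂ = 0} := by
      refine isClosed_eq (Continuous.inner ?_ continuous_const) continuous_const
      exact (WithLp.sndL 2 ℂ (L2 N) (PiLp 2 fun _ : Fin N => L2 N)).continuous
    refine closure_minimal ?_ hc hv
    intro v hv
    obtain ⟨φ, hφ, rfl⟩ := mem_testGraph_iff.1 hv
    change ⟪_, _⟫_ℂ = 0
    rw [inner_smoothPair_snd (hX u.2) hφ, h φ hφ, neg_zero]

theorem laplaceL2_mem_V {N : ℕ} {φ : (Fin N → ℝ) → ℂ} (hφ : IsCubeTest φ) :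
    laplaceL2 φ hφ.smooth ∈ V N := by
  rw [V, Submodule.mem_orthogonal']
  rintro _ ⟨u, hu, rfl⟩
  exact (mem_weaklyHarmonic_iff le_rfl).1 hu φ hφ

/-- The space `V` contains enough functions, namely all Laplacians of test functions, to detect
harmonicity. This is the source of the density of the embeddings. -/
theorem mem_HarTorus_of_mem_orthogonal_V {N : ℕ} {u : H1Torus N} (hu : u.1.fst ∈ (V N)ᗮ) :
    u ∈ HarTorus N :=
  (mem_weaklyHarmonic_iff (H1Torus_le_H1Cube N)).2 fun _ hφ =>
    (Submodule.mem_orthogonal _ _).1 hu _ (laplaceL2_mem_V hφ)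

theorem V_le_Vtilde (N : ℕ) : V N ≤ Vtilde N := by
  refine Submodule.orthogonal_le ?_
  rintro _ ⟨u, hu, rfl⟩
  exact ⟨⟨u.1, H1Torus_le_H1Cube N u.2⟩, hu, rfl⟩

/-! ### The Fourier basis -/

/-- The exponential `x ↦ exp (2πi k·x)` in `L²` of the cube. -/
noncomputable def fourierL2 {N : ℕ} (k : Fin N → ℤ) : L2 N :=
  contL2 (fun x => conj (expChar k x)) (contDiff_conj (contDiff_expChar k)).continuous

theorem inner_fourierL2 {N : ℕ} (k : Fin N → ℤ) (u : L2 N) :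
    ⟪fourierL2 k, u⟫_ℂ = ∫ x in cube N, u x * expChar k x := by
  rw [fourierL2, inner_contL2]
  simp

theorem hasSum_sq_inner_fourierL2 {N : ℕ} (u : L2 N) :
    HasSum (fun k : Fin N → ℤ => ‖⟪fourierL2 k, u⟫_ℂ‖ ^ 2) (‖u‖ ^ 2) := by
  simpa only [inner_fourierL2] using hasSum_sq_expChar u

theorem conj_expChar_mul_self {N : ℕ} (k : Fin N → ℤ) (x : Fin N → ℝ) :
    conj (expChar k x) * expChar k x = 1 := by
  rw [expChar, ← Complex.exp_conj, ← Complex.exp_add, ← Complex.exp_zero]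
  congr 1
  simp [Complex.conj_ofNat]

theorem norm_fourierL2 {N : ℕ} (k : Fin N → ℤ) : ‖fourierL2 k‖ = 1 := by
  have h : ⟪fourierL2 k, fourierL2 k⟫_ℂ = 1 := by
    rw [inner_fourierL2]
    have : ∫ x in cube N, (fourierL2 k : L2 N) x * expChar k x = ∫ x in cube N, (1 : ℂ) := by
      refine integral_congr_ae ?_
      filter_upwards [contL2_ae (contDiff_conj (contDiff_expChar k)).continuous] with x hx
      rw [fourierL2, hx, conj_expChar_mul_self]
    have h2 : volume (cube N) = 1 := by
      rw [cube, Real.volume_pi_Ioo]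
      simp
    rw [this]
    simp [measureReal_def, h2]
  have h' : ‖fourierL2 k‖ ^ 2 = 1 := by rw [← inner_self_eq_norm_sq (𝕜 := ℂ), h]; simp
  exact (pow_eq_one_iff_of_nonneg (norm_nonneg _) two_ne_zero).1 h'

/-- In Parseval's identity for the unit vector `fourierL2 k`, the `k`-th term already accounts for
the whole sum `1`, so every other coefficient vanishes. -/
theorem orthonormal_fourierL2 (N : ℕ) : Orthonormal ℂ (fourierL2 : (Fin N → ℤ) → L2 N) := by
  classical
  refine ⟨norm_fourierL2, fun j k hjk => ?_⟩
  have h := sum_le_hasSum {j, k} (fun _ _ => by positivity)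
    (hasSum_sq_inner_fourierL2 (fourierL2 k))
  rw [Finset.sum_pair hjk, inner_self_eq_norm_sq_to_K, norm_fourierL2] at h
  norm_num at h
  exact h

/-- The exponentials as elements of `H¹(T^N)`. -/
noncomputable def fourierH1 {N : ℕ} (k : Fin N → ℤ) : H1Torus N :=
  ⟨_, smoothPair_mem_H1Torus (isTorusTest_expChar k).conj⟩

theorem fourierH1_fst {N : ℕ} (k : Fin N → ℤ) : (fourierH1 k).1.fst = fourierL2 k := rfl

theorem inner_fourierL2_snd {N : ℕ} (u : H1Torus N) (k : Fin N → ℤ) (i : Fin N) :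
    ⟪fourierL2 k, u.1.snd i⟫_ℂ = (2 * Real.pi * Complex.I * k i) * ⟪fourierL2 k, u.1.fst⟫_ℂ := by
  rw [inner_fourierL2, inner_fourierL2]
  have := u.2 (expChar k) (isTorusTest_expChar k) i
  rw [← integral_const_mul, ← neg_inj, ← this, ← integral_neg]
  refine integral_congr_ae (Filter.Eventually.of_forall fun x => ?_)
  simp only [partialD_expChar]
  ring

/-- Parseval's identity for the gradient. -/
theorem hasSum_sq_gradient {N : ℕ} (u : H1Torus N) :
    HasSum (fun k : Fin N → ℤ =>
      (∑ i, (2 * Real.pi * k i) ^ 2) * ‖⟪fourierL2 k, u.1.fst⟫_ℂ‖ ^ 2) (‖u.1.snd‖ ^ 2) := by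
  rw [PiLp.norm_sq_eq_of_L2]
  convert! hasSum_sum fun i (_ : i ∈ Finset.univ) => hasSum_sq_inner_fourierL2 (u.1.snd i) using 2
    with k
  rw [Finset.sum_mul]
  refine Finset.sum_congr rfl fun i _ => ?_
  have : ‖2 * (Real.pi : ℂ) * Complex.I * k i‖ = |2 * Real.pi * k i| := by
    simp [abs_mul, abs_of_pos Real.pi_pos]
  rw [inner_fourierL2_snd, norm_mul, this, mul_pow |2 * Real.pi * k i|, sq_abs]

/-- The weights of the Dirichlet integral tend to infinity with the frequency, which is what makes
the embedding compact. -/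
theorem finite_sum_sq_lt (N : ℕ) (C : ℝ) :
    {k : Fin N → ℤ | ∑ i, (2 * Real.pi * k i) ^ 2 < C}.Finite := by
  refine (Set.finite_Icc (fun _ => -⌈C⌉ : Fin N → ℤ) (fun _ => ⌈C⌉)).subset ?_
  intro k hk
  have h : ∀ i, |k i| ≤ ⌈C⌉ := by
    intro i
    have h1 := Finset.single_le_sum (f := fun i => (2 * Real.pi * k i) ^ 2)
      (fun _ _ => sq_nonneg _) (Finset.mem_univ i)
    have h2 : (2 * Real.pi * k i) ^ 2 < C := h1.trans_lt hk
    -- Valid because `k i` is an integer; it gives the box of radius `⌈C⌉` without a square root.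
    have h3 : |(k i : ℝ)| ≤ (k i : ℝ) ^ 2 := by
      have : |k i| ≤ k i ^ 2 := by
        rw [← sq_abs, sq]
        rw [Int.abs_eq_natAbs]
        exact_mod_cast Nat.le_mul_self (k i).natAbs
      exact_mod_cast this
    have h4 : (k i : ℝ) ^ 2 ≤ (2 * Real.pi * k i) ^ 2 := by
      rw [mul_pow]
      refine le_mul_of_one_le_left (sq_nonneg _) ?_
      nlinarith [Real.pi_gt_three]
    have h5 : ((|k i| : ℤ) : ℝ) ≤ ⌈C⌉ := by
      push_cast
      linarith [Int.le_ceil C]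
    exact_mod_cast h5
  exact ⟨fun i => (abs_le.1 (h i)).1, fun i => (abs_le.1 (h i)).2⟩

/-! ### A compactness criterion by Fourier weights -/

/-- An operator on a Hilbert space whose components in an orthonormal family satisfying Parseval's
identity decay uniformly has a compact adjoint. -/
theorem isCompactOperator_adjoint_of_weighted {κ X Y : Type*} [NormedAddCommGroup X]
    [InnerProductSpace ℂ X] [CompleteSpace X] [NormedAddCommGroup Y] [InnerProductSpace ℂ Y]
    [CompleteSpace Y] {b : κ → Y} (hb : Orthonormal ℂ b)
    (hpars : ∀ y, HasSum (fun k => ‖⟪b k, y⟫_ℂ‖ ^ 2) (‖y‖ ^ 2)) (T : X →L[ℂ] Y) (w : κ → ℝ)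
    (hw : ∀ C, {k | w k < C}.Finite)
    (hT : ∀ x, ∃ s ≤ ‖x‖ ^ 2, HasSum (fun k => w k * ‖⟪b k, T x⟫_ℂ‖ ^ 2) s) (hw0 : ∀ k, 0 ≤ w k) :
    IsCompactOperator T.adjoint := by
  change T.adjoint ∈ {f : Y →L[ℂ] X | IsCompactOperator f}
  -- Compact operators are closed in operator norm, so it suffices to approximate `T*` by `T* P`,
  -- with `P` the projection onto a finite span of the `b k`.
  rw [← isClosed_setOfPred_isCompactOperator.closure_eq, Metric.mem_closure_iff]
  intro ε hε
  -- Outside `F` the weight is at least `(2 / ε) ^ 2`, so the weighted sum controls the tail of `T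
  -- x` with the factor `ε / 2`.
  let F := (hw ((2 / ε) ^ 2)).toFinset
  let U : Submodule ℂ Y := Submodule.span ℂ (b '' F)
  have : FiniteDimensional ℂ U := FiniteDimensional.span_of_finite ℂ (F.finite_toSet.image b)
  have : ProperSpace U := FiniteDimensional.proper_rclike ℂ U
  refine ⟨T.adjoint.comp (U.subtypeL.comp U.orthogonalProjectionOnto), ?_, ?_⟩
  · exact (isCompactOperator_of_locallyCompactSpace_dom U.orthogonalProjectionOnto).clm_comp
      (T.adjoint.comp U.subtypeL)
  have hsmall : ∀ x, ‖Uᗮ.starProjection (T x)‖ ≤ ε / 2 * ‖x‖ := by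
    intro x
    obtain ⟨s, hs, hsum⟩ := hT x
    have hle : ‖Uᗮ.starProjection (T x)‖ ^ 2 ≤ (ε / 2) ^ 2 * s := by
      refine hasSum_le (fun k => ?_) (hpars _) (hsum.mul_left ((ε / 2) ^ 2))
      by_cases hk : k ∈ F
      · have h0 : ⟪b k, Uᗮ.starProjection (T x)⟫_ℂ = 0 :=
          (Submodule.mem_orthogonal _ _).1 (Submodule.starProjection_apply_mem _ _) _
            (Submodule.subset_span ⟨k, hk, rfl⟩)
        rw [h0]
        have := hw0 k
        simp only [norm_zero, ne_eq, OfNat.ofNat_ne_zero, not_false_eq_true, zero_pow]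
        positivity
      · have hbk : b k ∈ Uᗮ := by
          refine (Submodule.mem_orthogonal _ _).2 fun u hu => ?_
          have hle : U ≤ (ℂ ∙ b k)ᗮ := by
            refine Submodule.span_le.2 ?_
            rintro _ ⟨j, hj, rfl⟩
            refine Submodule.mem_orthogonal_singleton_iff_inner_left.2 (hb.2 ?_)
            rintro rfl
            exact hk hj
          exact Submodule.mem_orthogonal_singleton_iff_inner_left.1 (hle hu)
        have h0 : ⟪b k, Uᗮ.starProjection (T x)⟫_ℂ = ⟪b k, T x⟫_ℂ := by
          rw [← Submodule.inner_starProjection_left_eq_right,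
            Submodule.starProjection_eq_self_iff.2 hbk]
        rw [h0, ← mul_assoc]
        refine le_mul_of_one_le_left (by positivity) ?_
        have hwk : (2 / ε) ^ 2 ≤ w k := by
          by_contra h
          exact hk ((hw _).mem_toFinset.2 (not_le.1 h))
        calc (1 : ℝ) = (ε / 2) ^ 2 * (2 / ε) ^ 2 := by field_simp
          _ ≤ _ := by gcongr
    refine abs_le_of_sq_le_sq' ?_ (by positivity) |>.2
    rw [mul_pow]
    exact hle.trans (by gcongr)
  rw [dist_eq_norm]
  refine lt_of_le_of_lt (ContinuousLinearMap.opNorm_le_bound _ (half_pos hε).le fun y => ?_)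
    (half_lt_self hε)
  have h1 : (T.adjoint - T.adjoint.comp (U.subtypeL.comp U.orthogonalProjectionOnto)) y =
      T.adjoint (Uᗮ.starProjection y) := by
    rw [Submodule.starProjection_orthogonal]
    exact (map_sub T.adjoint y _).symm
  rw [h1]
  set z := T.adjoint (Uᗮ.starProjection y) with hz
  -- Duality, with `Q` the projection onto `Uᗮ`: pairing `z = T* Q y` with itself transfers the
  -- bound on `Q T` to its adjoint `T* Q`.
  have h2 : ‖z‖ ^ 2 = ‖⟪Uᗮ.starProjection (T z), y⟫_ℂ‖ := by
    rw [Submodule.inner_starProjection_left_eq_right, ← ContinuousLinearMap.adjoint_inner_right,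
      ← hz, inner_self_eq_norm_sq_to_K]
    simp
  have h3 : ‖z‖ ^ 2 ≤ ε / 2 * ‖z‖ * ‖y‖ := by
    rw [h2]
    exact (norm_inner_le_norm _ _).trans (by gcongr; exact hsmall z)
  rcases (norm_nonneg z).eq_or_lt with h0 | h0
  · rw [← h0]
    positivity
  · nlinarith

/-! ### Equivalence of the norms of `H⁻¹(T^N)` -/

theorem norm_sq_HNegOne {N : ℕ} (w : HNegOne N) :
    ‖w‖ ^ 2 = ‖gradH N (potential (toDualH1 N w))‖ ^ 2 + ‖mu0 (toDualH1 N w)‖ ^ 2 := by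
  have h : ⟪w, w⟫_ℂ = ⟪gradH N (potential (toDualH1 N w)), gradH N (potential (toDualH1 N w))⟫_ℂ +
    conj (mu0 (toDualH1 N w)) * mu0 (toDualH1 N w) := rfl
  rw [← inner_self_eq_norm_sq (𝕜 := ℂ), h, map_add, inner_self_eq_norm_sq, RCLike.conj_mul]
  norm_cast

theorem norm_H1Torus_sq {N : ℕ} (u : H1Torus N) : ‖u‖ ^ 2 = ‖u.1.fst‖ ^ 2 + ‖u.1.snd‖ ^ 2 :=
  WithLp.prod_norm_sq_eq_of_L2 u.1

theorem norm_gradH_le {N : ℕ} (u : H1Torus N) : ‖gradH N u‖ ≤ ‖u‖ := by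
  refine abs_le_of_sq_le_sq' ?_ (norm_nonneg _) |>.2
  rw [norm_H1Torus_sq, gradH_apply]
  exact le_add_of_nonneg_left (sq_nonneg _)

theorem norm_fst_le {N : ℕ} (u : H1Torus N) : ‖u.1.fst‖ ≤ ‖u‖ := by
  refine abs_le_of_sq_le_sq' ?_ (norm_nonneg _) |>.2
  rw [norm_H1Torus_sq]
  exact le_add_of_nonneg_right (sq_nonneg _)

theorem fourierL2_zero (N : ℕ) : fourierL2 0 = (one N).1.fst := by
  refine Lp.ext ((contL2_ae (contDiff_conj (contDiff_expChar 0)).continuous).trans ?_)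
  refine Filter.EventuallyEq.trans ?_
    (contL2_ae (N := N) (φ := fun _ => 1) continuous_const).symm
  refine Filter.Eventually.of_forall fun x => ?_
  simp [expChar]

theorem meanH_eq_inner {N : ℕ} (u : H1Torus N) : meanH N u = ⟪fourierL2 0, u.1.fst⟫_ℂ := by
  rw [meanH_apply, inner_fourierL2]
  simp [expChar]

theorem norm_meanH_le {N : ℕ} (u : H1Torus N) : ‖meanH N u‖ ≤ ‖u‖ := by
  rw [meanH_eq_inner]
  refine (norm_inner_le_norm _ _).trans ?_
  rw [norm_fourierL2, one_mul]
  exact norm_fst_le u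

theorem norm_one_H1Torus (N : ℕ) : ‖one N‖ = 1 := by
  have h : ‖one N‖ ^ 2 = 1 := by
    rw [norm_H1Torus_sq, ← fourierL2_zero, norm_fourierL2, ← gradH_apply, gradH_one]
    simp
  exact (pow_eq_one_iff_of_nonneg (norm_nonneg _) two_ne_zero).1 h

/-- The equation of the potential expresses `w v` through the mean and the gradient of `v`, each
bounded by `‖v‖`, with coefficients bounded by the new norm of `w`. -/
theorem norm_toDualH1_le {N : ℕ} (w : HNegOne N) : ‖toDualH1 N w‖ ≤ 2 * ‖w‖ := by
  have hw := norm_sq_HNegOne w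
  set u := potential (toDualH1 N w) with hu
  set m := mu0 (toDualH1 N w) with hm
  have h1 : ‖gradH N u‖ ≤ ‖w‖ :=
    abs_le_of_sq_le_sq' (by rw [hw]; exact le_add_of_nonneg_right (sq_nonneg _))
      (norm_nonneg _) |>.2
  have h2 : ‖m‖ ≤ ‖w‖ :=
    abs_le_of_sq_le_sq' (by rw [hw]; exact le_add_of_nonneg_left (sq_nonneg _))
      (norm_nonneg _) |>.2
  refine ContinuousLinearMap.opNorm_le_bound _ (by positivity) fun v => ?_
  have h3 := ((isPotential_iff _ _).1 (isPotential_potential (toDualH1 N w))).2 v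
  have h4 : toDualH1 N w v = m * conj (meanH N v) - ⟪gradH N v, gradH N u⟫_ℂ := by
    rw [h3]
    ring
  calc ‖toDualH1 N w v‖ ≤ ‖m‖ * ‖meanH N v‖ + ‖gradH N v‖ * ‖gradH N u‖ := by
        rw [h4]
        refine (norm_sub_le _ _).trans (add_le_add ?_ (norm_inner_le_norm _ _))
        rw [norm_mul, RCLike.norm_conj]
    _ ≤ ‖w‖ * ‖v‖ + ‖v‖ * ‖w‖ := by
        gcongr
        · exact norm_meanH_le v
        · exact norm_gradH_le v
    _ = 2 * ‖w‖ * ‖v‖ := by ring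

/-- Testing the equation of the potential `u` with `u` itself, which has mean zero, bounds `‖∇u‖²`
by the dual norm times `‖u‖`; Poincaré's inequality absorbs `‖u‖`. The moment is the value at the
unit vector `one N`. -/
theorem norm_HNegOne_le {N : ℕ} (w : HNegOne N) : ‖w‖ ≤ 3 * ‖toDualH1 N w‖ := by
  have hw := norm_sq_HNegOne w
  obtain ⟨h0, h3⟩ := (isPotential_iff _ _).1 (isPotential_potential (toDualH1 N w))
  set u := potential (toDualH1 N w) with hu
  have hm : ‖mu0 (toDualH1 N w)‖ ≤ ‖toDualH1 N w‖ := by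
    refine ((toDualH1 N w).le_opNorm (one N)).trans ?_
    rw [norm_one_H1Torus, mul_one]
  have h4 : ‖gradH N u‖ ^ 2 ≤ ‖toDualH1 N w‖ * ‖u‖ := by
    have h5 := h3 u
    rw [h0, map_zero, mul_zero, sub_zero] at h5
    rw [← inner_self_eq_norm_sq (𝕜 := ℂ), h5]
    refine (RCLike.re_le_norm _).trans ?_
    rw [norm_neg]
    exact (toDualH1 N w).le_opNorm u
  have h6 := norm_sq_le u h0
  have h7 : ‖u‖ ≤ 2 * ‖gradH N u‖ := by
    refine abs_le_of_sq_le_sq' ?_ (by positivity) |>.2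
    nlinarith [sq_nonneg ‖gradH N u‖]
  have h8 : ‖gradH N u‖ ≤ 2 * ‖toDualH1 N w‖ := by
    rcases (norm_nonneg (gradH N u)).eq_or_lt with h | h
    · rw [← h]
      positivity
    · nlinarith [mul_le_mul_of_nonneg_left h7 (norm_nonneg (toDualH1 N w))]
  -- The bounds `2` for the gradient and `1` for the moment give `2² + 1² ≤ 3²`.
  refine abs_le_of_sq_le_sq' ?_ (by positivity) |>.2
  rw [hw]
  nlinarith [norm_nonneg (gradH N u), norm_nonneg (mu0 (toDualH1 N w)),
    norm_nonneg (toDualH1 N w)]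

/-! ### The embeddings -/

/-- Let `T : X → Y` have dense range and compact adjoint, let `D` be a renorming of the antidual of
`X` and `K` the annihilator in `D` of a subspace `A` of `X`. A subspace `W` of `Y` for which
`T⁻¹ Wᗮ = A` is densely and compactly embedded in `K`. -/
theorem exists_dense_compact_embedding {X Y D : Type*} [NormedAddCommGroup X]
    [InnerProductSpace ℂ X] [CompleteSpace X] [NormedAddCommGroup Y] [InnerProductSpace ℂ Y]
    [CompleteSpace Y] [NormedAddCommGroup D] [NormedSpace ℂ D] (e : D ≃L[ℂ] (X →L⋆[ℂ] ℂ))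
    (T : X →L[ℂ] Y) (hT : ∀ f, (∀ v, ⟪T v, f⟫_ℂ = 0) → f = 0) (hTc : IsCompactOperator T.adjoint)
    (A : Submodule ℂ X) (K : Submodule ℂ D) (hK : ∀ w, w ∈ K ↔ ∀ v ∈ A, e w v = 0)
    (W : Submodule ℂ Y) (hWA : ∀ f ∈ W, ∀ v ∈ A, ⟪T v, f⟫_ℂ = 0) (hW : ∀ u, T u ∈ Wᗮ → u ∈ A) :
    ∃ j : W →L[ℂ] K, (∀ (f : W) v, e (j f) v = ⟪T v, (f : Y)⟫_ℂ) ∧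
      Function.Injective j ∧ DenseRange j ∧ IsCompactOperator j := by
  -- The Riesz map, which is linear because the dual is antilinear. The embedding will be `R`
  -- composed with `T*` restricted to `W`.
  let R : X →L[ℂ] D := (e.symm : (X →L⋆[ℂ] ℂ) →L[ℂ] D).comp (innerSL ℂ (E := X)).flip
  have hR : ∀ z v, e (R z) v = ⟪v, z⟫_ℂ := fun z v => by simp [R]
  have hRsurj : Function.Surjective R := fun w => by
    let g : X →L[ℂ] ℂ := (starL ℂ : ℂ ≃L⋆[ℂ] ℂ).toContinuousLinearMap.comp (e w)
    refine ⟨(InnerProductSpace.toDual ℂ X).symm g, e.injective (ContinuousLinearMap.ext fun v => ?_)⟩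
    rw [hR, ← inner_conj_symm, InnerProductSpace.toDual_symm_apply]
    simp [g]
  let B : W →L[ℂ] X := T.adjoint.comp W.subtypeL
  have hB : ∀ (f : W) v, ⟪v, B f⟫_ℂ = ⟪T v, (f : Y)⟫_ℂ := fun f v =>
    ContinuousLinearMap.adjoint_inner_right T v f
  have hmem : ∀ f : W, R.comp B f ∈ K := fun f => (hK _).2 fun v hv =>
    (hR _ _).trans ((hB f v).trans (hWA f f.2 v hv))
  have hclosed : IsClosed (K : Set D) := by
    have : (K : Set D) = ⋂ v ∈ A, {w | e w v = 0} := by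
      ext w
      simp only [Set.mem_iInter, SetLike.mem_coe, hK w, Set.mem_ofPred_eq]
    rw [this]
    refine isClosed_biInter fun v _ => isClosed_eq ?_ continuous_const
    exact (ContinuousLinearMap.apply' ℂ (starRingEnd ℂ) v).continuous.comp e.continuous
  have hval : ∀ (f : W) v, e (R.comp B f) v = ⟪T v, (f : Y)⟫_ℂ := fun f v =>
    (hR _ _).trans (hB f v)
  refine ⟨(R.comp B).codRestrict K hmem, hval, ?_, ?_, ?_⟩
  · refine (injective_iff_map_eq_zero _).2 fun f hf => Subtype.ext (hT _ fun v => ?_)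
    have h0 : R.comp B f = 0 := congrArg Subtype.val hf
    rw [← hval, h0, map_zero, zero_apply]
  -- The closure of the range of `B` is its double orthogonal complement, and `u` is orthogonal to
  -- that range exactly when `T u ∈ Wᗮ`, which puts `u` in `A`.
  · have hdense : Aᗮ ≤ B.range.topologicalClosure := by
      rw [← Submodule.orthogonal_orthogonal_eq_closure]
      refine Submodule.orthogonal_le fun u hu => hW u ?_
      refine (Submodule.mem_orthogonal' _ _).2 fun f hf => ?_
      rw [← hB ⟨f, hf⟩]
      exact (Submodule.mem_orthogonal' _ _).1 hu _ ⟨⟨f, hf⟩, rfl⟩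
    intro w
    obtain ⟨z, hz⟩ := hRsurj w.1
    -- Under `R`, membership in the annihilator `K` means orthogonality to `A`.
    have hz' : z ∈ Aᗮ := by
      refine (Submodule.mem_orthogonal _ _).2 fun v hv => ?_
      rw [← hR, hz]
      exact (hK _).1 w.2 v hv
    rw [Topology.IsInducing.subtypeVal.closure_eq_preimage_closure_image, Set.mem_preimage, ← hz]
    refine closure_mono ?_ (image_closure_subset_closure_image R.continuous
      ⟨z, hdense hz', rfl⟩)
    rintro _ ⟨_, ⟨f, rfl⟩, rfl⟩
    exact ⟨_, ⟨f, rfl⟩, rfl⟩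
  · exact ((hTc.comp_clm W.subtypeL).clm_comp R).codRestrict hmem hclosed

/-! ### The inclusion of `H¹(T^N)` in `L²` and the spaces between `V` and `Ṽ` -/

/-- `toDualH1` as a continuous linear equivalence. -/
noncomputable def toDualL (N : ℕ) : HNegOne N ≃L[ℂ] DualH1 N :=
  LinearEquiv.toContinuousLinearEquivOfBounds (E := HNegOne N) (F := DualH1 N) (toDualH1 N) 2 3
    norm_toDualH1_le fun w => norm_HNegOne_le (N := N) w

/-- A bounded linear map between inner product spaces; the instances in its type are those of the
general theorems above, which speeds up unification. -/
noncomputable def boundedMap {X Y : Type*} [NormedAddCommGroup X] [InnerProductSpace ℂ X]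
    [NormedAddCommGroup Y] [InnerProductSpace ℂ Y] (f : X →ₗ[ℂ] Y) (hf : ∀ x, ‖f x‖ ≤ ‖x‖) :
    X →L[ℂ] Y :=
  f.mkContinuous 1 fun x => by simpa using hf x

/-- The embedding of `H¹(T^N)` into `L²`. -/
noncomputable def embL2 (N : ℕ) :=
  boundedMap (X := H1Torus N) (Y := L2 N) (toL2 (H1Torus N)) norm_fst_le

theorem embL2_apply {N : ℕ} (u : H1Torus N) : embL2 N u = u.1.fst := rfl

/-- The exponentials belong to `H¹(T^N)`, so all Fourier coefficients of `f` vanish and Parseval's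
identity applies. -/
theorem eq_zero_of_inner_embL2 {N : ℕ} {f : L2 N} (hf : ∀ v, ⟪embL2 N v, f⟫_ℂ = 0) : f = 0 := by
  have h : ∀ k, ⟪fourierL2 k, f⟫_ℂ = 0 := fun k => by
    rw [← fourierH1_fst, ← embL2_apply]
    exact hf _
  have h2 := hasSum_sq_inner_fourierL2 f
  simp only [h, norm_zero, ne_eq, OfNat.ofNat_ne_zero, not_false_eq_true, zero_pow] at h2
  have h3 := h2.unique hasSum_zero
  exact norm_eq_zero.1 ((pow_eq_zero_iff two_ne_zero).1 h3)

theorem exists_hasSum_weighted_embL2 {N : ℕ} (u : H1Torus N) : ∃ s ≤ ‖u‖ ^ 2,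
    HasSum (fun k : Fin N → ℤ =>
      (∑ i, (2 * Real.pi * k i) ^ 2) * ‖⟪fourierL2 k, embL2 N u⟫_ℂ‖ ^ 2) s := by
  refine ⟨‖u.1.snd‖ ^ 2, ?_, ?_⟩
  · rw [norm_H1Torus_sq]
    exact le_add_of_nonneg_left (sq_nonneg _)
  · rw [embL2_apply]
    exact hasSum_sq_gradient u

theorem inner_embL2_of_mem_HarTorus {N : ℕ} {f : L2 N} (hf : f ∈ Vtilde N) {v : H1Torus N}
    (hv : v ∈ HarTorus N) : ⟪embL2 N v, f⟫_ℂ = 0 :=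
  (Submodule.mem_orthogonal _ _).1 hf _ (Submodule.mem_map_of_mem hv)

theorem inner_embL2 {N : ℕ} (v : H1Torus N) (f : L2 N) :
    ⟪embL2 N v, f⟫_ℂ = ∫ x in cube N, f x * conj (v.1.fst x) := by
  rw [embL2_apply, MeasureTheory.L2.inner_def]
  simp only [RCLike.inner_apply]

/-- The two inclusions play opposite roles: `W ≤ Ṽ` puts the functionals in `H`, while `V ≤ W` makes
them dense there. -/
theorem denselyCompactlyEmbeddedInH {N : ℕ} {W : Submodule ℂ (L2 N)} (hV : V N ≤ W)
    (hW : W ≤ Vtilde N) : DenselyCompactlyEmbeddedInH W := by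
  have hcompact := isCompactOperator_adjoint_of_weighted (X := H1Torus N) (Y := L2 N)
    (orthonormal_fourierL2 N) hasSum_sq_inner_fourierL2 (embL2 N)
    (fun k => ∑ i, (2 * Real.pi * k i) ^ 2) (finite_sum_sq_lt N)
    exists_hasSum_weighted_embL2 fun _ => Finset.sum_nonneg fun _ _ => sq_nonneg _
  obtain ⟨j, hj, h⟩ := exists_dense_compact_embedding (X := H1Torus N) (Y := L2 N)
    (D := HNegOne N) (toDualL N) (embL2 N) (fun f hf => eq_zero_of_inner_embL2 hf)
    hcompact (HarTorus N) (H N) (fun w => Iff.rfl) W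
    (fun f hf v hv => inner_embL2_of_mem_HarTorus (hW hf) hv)
    (fun u hu => mem_HarTorus_of_mem_orthogonal_V (Submodule.orthogonal_le hV hu))
  exact ⟨j, fun f v => (hj f v).trans (inner_embL2 v f), h⟩

end MomentHeat

theorem theorem3 (N : ℕ) (hN : 1 ≤ N) :
    (IsClosed (MomentHeat.V N : Set (MomentHeat.L2 N)) ∧
      IsClosed (MomentHeat.Vtilde N : Set (MomentHeat.L2 N))) ∧
    (∃ c C : ℝ, 0 < c ∧ 0 < C ∧ ∀ w : MomentHeat.HNegOne N,
      c * ‖MomentHeat.toDualH1 N w‖ ≤ ‖w‖ ∧ ‖w‖ ≤ C * ‖MomentHeat.toDualH1 N w‖) ∧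
    MomentHeat.DenselyCompactlyEmbeddedInH (MomentHeat.V N) ∧
    MomentHeat.DenselyCompactlyEmbeddedInH (MomentHeat.Vtilde N) := by
  refine ⟨⟨Submodule.isClosed_orthogonal _, Submodule.isClosed_orthogonal _⟩,
    -- The constant `1 / 2` is the inverse of the factor `2` in `norm_toDualH1_le`.
    ⟨1 / 2, 3, by norm_num, by norm_num, fun w => ⟨?_, MomentHeat.norm_HNegOne_le w⟩⟩,
    MomentHeat.denselyCompactlyEmbeddedInH le_rfl (MomentHeat.V_le_Vtilde N),
    MomentHeat.denselyCompactlyEmbeddedInH (MomentHeat.V_le_Vtilde N) le_rfl⟩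
  linarith [MomentHeat.norm_toDualH1_le w]
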